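/- Let $n\ge 1$, let $\mathcal L^n$ be the Lebesgue measure on $\mathbb R^n$, and let $\varphi:[0,\infty)\to[0,\infty)$ be a concave function that does not vanish identically. For a measurable function $u:\mathbb R^n\to[-\infty,\infty]$ put $$u_*(t)=\mathcal L^n(\{y:|u(y)|>t\}),\qquad u^*(s)=\inf\{t\ge 0: u_*(t)\le s\},\qquad u^{**}(s)=\frac1s\int_0^s u^*(t)\,dt,$$ for $t\ge0$, $s\ge 0$ and $s>0$ respectively (with $\inf\emptyset=\infty$), and define the Marcinkiewicz endpoint norm by $$\|u\|_{M_\varphi(\mathbb R^n)}=\sup_{s\in(0,\infty)}u^{**}(s)\,\varphi(s)\in[0,\infty].$$ For $\|\cdot\|_X$ equal to $\|\cdot\|_{M_\varphi(\mathbb R^n)}$ or to $\|u\|_{L^1(\mathbb R^n)}=\int_{\mathbb R^n}|u|\,d\mathcal L^n$, let $X_{\mathrm{loc}}(\mathbb R^n)$ be the set of all measurable $u:\mathbb R^n\to[-\infty,\infty]$ such that $\|u\chi_K\|_X<\infty$ for every bounded measurable set $K\subset\mathbb R^n$. For a measurable set $G\subset\mathbb R^n$ with $0<\mathcal L^n(G)<\infty$,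 let $$\|u\|^{\oslash}_{X(G)}=\big\|(u\chi_G)\big(\mathcal L^n(G)^{1/n}\,\cdot\,\big)\big\|_{X}$$ be the averaged norm on $G$. The norm $\|\cdot\|_X$ is said to satisfy the Lebesgue point property if, for every $u\in X_{\mathrm{loc}}(\mathbb R^n)$, $$\lim_{r\to0^+}\|u-u(x)\|^{\oslash}_{X(B_r(x))}=0\qquad\text{for a.e. }x\in\mathbb R^n,$$ where $B_r(x)$ is the ball of radius $r$ centred at $x$. Then the limit $\lim_{s\to0^+}\frac{s}{\varphi(s)}$ exists and is finite, and the following are equivalent: 1. $\|\cdot\|_{M_\varphi(\mathbb R^n)}$ satisfies the Lebesgue point property; 2. $\displaystyle\lim_{s\to0^+}\frac{s}{\varphi(s)}>0$; 3. $(M_\varphi)_{\mathrm{loc}}(\mathbb R^n)=L^1_{\mathrm{loc}}(\mathbb R^n)$ (as sets of functions). -/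

import Mathlib

open MeasureTheory Set Filter Topology
open scoped ENNReal NNReal

namespace RINorm

/-- `ℝⁿ` with its Euclidean distance and Lebesgue measure. -/
abbrev Rn (n : ℕ) : Type := EuclideanSpace ℝ (Fin n)

/-- The distribution function `t ↦ ℒⁿ {y : |u y| > t}`, for `t ∈ [0, ∞)`. -/
noncomputable def distribution {n : ℕ} (u : Rn n → EReal) (t : ℝ≥0) : ℝ≥0∞ :=
  volume {y : Rn n | (t : ℝ≥0∞) < (u y).abs}

/-- The decreasing rearrangement `u*(s) = inf {t ≥ 0 : u_*(t) ≤ s}` with values in `[0, ∞]`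
(`inf ∅ = ∞`); it is only used for `s ≥ 0`. -/
noncomputable def rearrangement {n : ℕ} (u : Rn n → EReal) (s : ℝ) : ℝ≥0∞ :=
  ⨅ (t : ℝ≥0) (_ : distribution u t ≤ ENNReal.ofReal s), (t : ℝ≥0∞)

/-- The maximal rearrangement `u**(s) = (1 / s) ∫₀ˢ u*(t) dt`, for `s > 0`. -/
noncomputable def maximalRearrangement {n : ℕ} (u : Rn n → EReal) (s : ℝ) : ℝ≥0∞ :=
  (ENNReal.ofReal s)⁻¹ * ∫⁻ t in Ioo (0 : ℝ) s, rearrangement u t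

/-- The Marcinkiewicz endpoint norm `sup_{s > 0} u**(s) φ(s)`, with values in `[0, ∞]`. -/
noncomputable def marcinkiewiczNorm (n : ℕ) (φ : ℝ → ℝ) (u : Rn n → EReal) : ℝ≥0∞ :=
  ⨆ s ∈ Ioi (0 : ℝ), maximalRearrangement u s * ENNReal.ofReal (φ s)

/-- The `L¹` norm, with values in `[0, ∞]`. -/
noncomputable def lebesgueOneNorm (n : ℕ) (u : Rn n → EReal) : ℝ≥0∞ :=
  ∫⁻ y, (u y).abs

/-- The local space `X_loc(ℝⁿ)` of a functional `N = ‖·‖_X`: all Lebesgue measurable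
`u : ℝⁿ → [-∞, ∞]` with `‖u χ_K‖_X < ∞` for every bounded Lebesgue measurable set `K`. -/
def localSpace {n : ℕ} (N : (Rn n → EReal) → ℝ≥0∞) : Set (Rn n → EReal) :=
  {u | AEMeasurable u volume ∧
    ∀ K : Set (Rn n), Bornology.IsBounded K → NullMeasurableSet K volume →
      N (K.indicator u) < ∞}

/-- The averaged norm `‖u‖^⊘_{X(G)} = ‖(u χ_G)(ℒⁿ(G)^{1/n} ·)‖_X`, for `0 < ℒⁿ(G) < ∞`. -/
noncomputable def averagedNorm {n : ℕ} (N : (Rn n → EReal) → ℝ≥0∞) (G : Set (Rn n))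
    (u : Rn n → EReal) : ℝ≥0∞ :=
  N (fun y => G.indicator u ((volume.real G ^ (1 / (n : ℝ))) • y))

/-- The Lebesgue point property: for every `u ∈ X_loc(ℝⁿ)`,
`‖u - u(x)‖^⊘_{X(B_r(x))} → 0` as `r → 0⁺`, for almost every `x`. -/
def LebesguePointProperty {n : ℕ} (N : (Rn n → EReal) → ℝ≥0∞) : Prop :=
  ∀ u ∈ localSpace N, ∀ᵐ x ∂(volume : Measure (Rn n)),
    Tendsto (fun r : ℝ => averagedNorm N (Metric.ball x r) (fun y => u y - u x))
      (𝓝[>] 0) (𝓝 0)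

end RINorm

/-!
By concavity `φ` is nondecreasing and `φ s / s` is nonincreasing, so `s / φ s` decreases to its
infimum `L ≥ 0` as `s → 0⁺`.

All computations go through the formula `lintegral_rearrangement`, which writes `∫₀ˢ u*` as
`∫₀^∞ min (s, u_*(l)) dl`. It shows that for functions supported in a set of finite measure a finite
Marcinkiewicz norm implies integrability, and that for `L > 0` the Marcinkiewicz norm is at most
`L⁻¹` times the `L¹` norm. Hence for `L > 0` the two local spaces agree, and the Lebesgue point
property follows from Lebesgue's differentiation theorem, because rescaling by `ℒⁿ(G)^{1/n}`
divides the distribution function by `ℒⁿ(G)` (`distribution_averaged`).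

For `L = 0` there are scales `δ k` along which `δ k / φ (δ k)` decreases geometrically, and both
counterexamples have the form `sup_k a_k χ_{E_k}` with `ℒⁿ(E_k)` at most a constant times `δ k`.
With `a_k = 2 ^ k / φ (δ k)` and concentric balls `E_k` of volume comparable to `δ k`, the function
is integrable, but its Marcinkiewicz norm is at least a constant times `2 ^ k` for all `k`
(`localSpace_ne_of_tendsto_zero`). With
`a_k = 1 / φ (δ k)` its Marcinkiewicz norm is finite, since at `s` between `δ m` and `δ (m - 1)`
only a bounded quantity and a geometric tail contribute (`marcinkiewiczNorm_levelSup_le`). If now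
`E_k` is spread over the unit ball so as to have density comparable to `δ k` in every ball of
radius `7 / (k + 1)` (`exists_small_spread_set`), then the averaged norms at these radii stay bounded
below, also at the points outside all the `E_k`, where the function vanishes. The sets `E_k` are
so small together that these points have positive measure, and the Lebesgue point property fails
(`not_lebesguePointProperty_of_tendsto_zero`).
-/

namespace RINorm

/-! ### Nonnegative concave functions on the half-line -/

section Concave

variable {φ : ℝ → ℝ}

theorem _root_.ConcaveOn.mul_le_map_mul (hφ : ConcaveOn ℝ (Ici 0) φ)
    (h0 : ∀ s, 0 ≤ s → 0 ≤ φ s) {c s : ℝ} (hc : 0 ≤ c) (hc1 : c ≤ 1) (hs : 0 ≤ s) :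
    c * φ s ≤ φ (c * s) := by
  have h := hφ.2 (mem_Ici.2 hs) (mem_Ici.2 le_rfl) hc (sub_nonneg.2 hc1) (by ring)
  simp only [smul_eq_mul, mul_zero, add_zero] at h
  nlinarith [h0 0 le_rfl]

theorem _root_.ConcaveOn.mul_le_mul_of_le (hφ : ConcaveOn ℝ (Ici 0) φ)
    (h0 : ∀ s, 0 ≤ s → 0 ≤ φ s) {s t : ℝ} (hs : 0 < s) (hst : s ≤ t) :
    φ t * s ≤ φ s * t := by
  have ht : 0 < t := hs.trans_le hst
  have h := hφ.mul_le_map_mul h0 (div_nonneg hs.le ht.le) ((div_le_one ht).2 hst) ht.le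
  rw [div_mul_cancel₀ _ ht.ne', div_mul_eq_mul_div, div_le_iff₀ ht] at h
  linarith

theorem _root_.ConcaveOn.monotoneOn_Ici_of_nonneg (hφ : ConcaveOn ℝ (Ici 0) φ)
    (h0 : ∀ s, 0 ≤ s → 0 ≤ φ s) : MonotoneOn φ (Ici 0) := by
  intro s hs t ht hst
  by_contra! hlt
  rw [mem_Ici] at hs ht
  have hst' : s < t := lt_of_le_of_ne hst (by rintro rfl; exact lt_irrefl _ hlt)
  have hd : 0 < φ s - φ t := sub_pos.2 hlt
  have hq : 0 ≤ t * φ s / (φ s - φ t) := div_nonneg (mul_nonneg ht (h0 s hs)) hd.le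
  -- the chord from `s` through `t` falls below zero before reaching `T`
  set T := t + 1 + t * φ s / (φ s - φ t) with hT
  have hsT : 0 < T - s := by linarith
  have hα : 0 ≤ (T - t) / (T - s) := div_nonneg (by linarith) hsT.le
  have hβ : 0 ≤ (t - s) / (T - s) := div_nonneg (by linarith) hsT.le
  have h := hφ.2 (mem_Ici.2 hs) (mem_Ici.2 (show 0 ≤ T by linarith)) hα hβ
    (by rw [← add_div]; exact (div_eq_one_iff_eq hsT.ne').2 (by ring))
  have e : ((T - t) / (T - s)) • s + ((t - s) / (T - s)) • T = t := by
    simp only [smul_eq_mul]; field_simp; ring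
  rw [e] at h
  have h2 : (T - t) * φ s ≤ φ t * (T - s) := by
    have h3 : (T - t) / (T - s) * φ s ≤ φ t :=
      le_trans (le_add_of_nonneg_right (mul_nonneg hβ (h0 T (by linarith)))) h
    rwa [div_mul_eq_mul_div, div_le_iff₀ hsT] at h3
  have h4 : T * (φ s - φ t) = (t + 1) * (φ s - φ t) + t * φ s := by
    rw [hT, add_mul, div_mul_cancel₀ _ hd.ne']
  nlinarith [mul_nonneg hs (h0 t ht), mul_pos (show 0 < t + 1 by linarith) hd]

theorem _root_.ConcaveOn.pos_of_nonneg_of_ne_zero (hφ : ConcaveOn ℝ (Ici 0) φ)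
    (h0 : ∀ s, 0 ≤ s → 0 ≤ φ s) (hne : ∃ s, 0 ≤ s ∧ φ s ≠ 0) {s : ℝ} (hs : 0 < s) :
    0 < φ s := by
  obtain ⟨t, ht, hne⟩ := hne
  have hpos : 0 < φ t := lt_of_le_of_ne (h0 t ht) hne.symm
  rcases le_total t s with hts | hst
  · exact hpos.trans_le (hφ.monotoneOn_Ici_of_nonneg h0 ht hs.le hts)
  · have h := hφ.mul_le_mul_of_le h0 hs hst
    exact pos_of_mul_pos_left ((mul_pos hpos hs).trans_le h) ht

theorem _root_.ConcaveOn.exists_tendsto_div (hφ : ConcaveOn ℝ (Ici 0) φ)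
    (h0 : ∀ s, 0 ≤ s → 0 ≤ φ s) (hne : ∃ s, 0 ≤ s ∧ φ s ≠ 0) :
    ∃ L : ℝ, 0 ≤ L ∧ Tendsto (fun s : ℝ => s / φ s) (𝓝[>] 0) (𝓝 L) ∧
      ∀ s, 0 < s → L ≤ s / φ s := by
  have hpos := fun s (hs : 0 < s) => hφ.pos_of_nonneg_of_ne_zero h0 hne hs
  have hmono : MonotoneOn (fun s : ℝ => s / φ s) (Ioi 0) := by
    intro s hs t ht hst
    simp only
    rw [div_le_div_iff₀ (hpos s hs) (hpos t ht)]
    linarith [hφ.mul_le_mul_of_le h0 hs hst]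
  have hnn : ∀ y ∈ (fun s : ℝ => s / φ s) '' Ioi 0, 0 ≤ y := by
    rintro _ ⟨s, hs, rfl⟩
    exact div_nonneg (le_of_lt hs) (hpos s hs).le
  refine ⟨sInf ((fun s : ℝ => s / φ s) '' Ioi 0), Real.sInf_nonneg hnn,
    hmono.tendsto_nhdsGT ⟨0, hnn⟩, fun s hs => csInf_le ⟨0, hnn⟩ ⟨s, hs, rfl⟩⟩

end Concave

/-! ### Layer-cake formulas for the rearrangement -/

/-- The layer-cake formula for functions with values in `[0, ∞]`. -/
theorem lintegral_eq_lintegral_measure_ofReal_lt {α : Type*} [MeasurableSpace α]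
    {μ : Measure α} [SFinite μ] {f : α → ℝ≥0∞} (hf : AEMeasurable f μ) :
    ∫⁻ x, f x ∂μ = ∫⁻ l in Ioi (0 : ℝ), μ {x | ENNReal.ofReal l < f x} := by
  wlog hm : Measurable f generalizing f
  · rw [lintegral_congr_ae hf.ae_eq_mk, this hf.measurable_mk.aemeasurable hf.measurable_mk]
    refine lintegral_congr fun l => measure_congr ?_
    filter_upwards [hf.ae_eq_mk] with x hx
    exact congrArg (ENNReal.ofReal l < ·) hx.symm
  have hS : MeasurableSet {p : α × ℝ | ENNReal.ofReal p.2 < f p.1} :=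
    measurableSet_lt (ENNReal.measurable_ofReal.comp measurable_snd) (hm.comp measurable_fst)
  have hfx : ∀ x, f x = ∫⁻ l in Ioi (0 : ℝ),
      {p : α × ℝ | ENNReal.ofReal p.2 < f p.1}.indicator 1 (x, l) := by
    intro x
    have hSx : MeasurableSet {l : ℝ | ENNReal.ofReal l < f x} :=
      measurableSet_lt ENNReal.measurable_ofReal measurable_const
    have : ∀ l, {p : α × ℝ | ENNReal.ofReal p.2 < f p.1}.indicator (1 : α × ℝ → ℝ≥0∞) (x, l)
        = {l : ℝ | ENNReal.ofReal l < f x}.indicator 1 l := fun l => rfl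
    simp_rw [this]
    rw [lintegral_indicator_one hSx, Measure.restrict_apply hSx]
    rcases eq_or_ne (f x) ∞ with h | h
    · rw [h]
      simp
    · have : {l : ℝ | ENNReal.ofReal l < f x} ∩ Ioi 0 = Ioo 0 (f x).toReal := by
        ext l
        simp only [mem_inter_iff, mem_ofPred_eq, mem_Ioi, mem_Ioo]
        rw [and_comm]
        exact and_congr_right fun hl => ENNReal.ofReal_lt_iff_lt_toReal hl.le h
      rw [this, Real.volume_Ioo, sub_zero, ENNReal.ofReal_toReal h]
  calc ∫⁻ x, f x ∂μ = ∫⁻ x, (∫⁻ l in Ioi (0 : ℝ),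
      {p : α × ℝ | ENNReal.ofReal p.2 < f p.1}.indicator 1 (x, l)) ∂μ := lintegral_congr hfx
    _ = ∫⁻ l in Ioi (0 : ℝ), (∫⁻ x,
      {p : α × ℝ | ENNReal.ofReal p.2 < f p.1}.indicator 1 (x, l) ∂μ) :=
        lintegral_lintegral_swap (measurable_one.indicator hS).aemeasurable
    _ = _ := by
        refine lintegral_congr fun l => ?_
        exact lintegral_indicator_one (μ := μ) (s := {x | ENNReal.ofReal l < f x})
          (measurableSet_lt measurable_const hm)

theorem measurable_abs : Measurable EReal.abs :=
  EReal.measurable_of_measurable_real (by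
    simp only [EReal.abs_def]
    fun_prop)

variable {n : ℕ}

theorem distribution_antitone (u : Rn n → EReal) : Antitone (distribution u) :=
  fun _ _ h => measure_mono fun _ hy => lt_of_le_of_lt (ENNReal.coe_le_coe.2 h) hy

theorem distribution_mono {u v : Rn n → EReal} (h : ∀ y, (u y).abs ≤ (v y).abs) (t : ℝ≥0) :
    distribution u t ≤ distribution v t :=
  measure_mono fun y hy => lt_of_lt_of_le hy (h y)

/-- Right continuity of the distribution function, in the form of an upper bound. It holds without
measurability of `u`, by continuity of (outer) measures along increasing unions. -/
theorem distribution_le_of_forall_gt {u : Rn n → EReal} {t : ℝ≥0} {c : ℝ≥0∞}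
    (h : ∀ t' > t, distribution u t' ≤ c) : distribution u t ≤ c := by
  obtain ⟨x, hxm, hxt, hx⟩ := exists_seq_strictAnti_tendsto t
  have hU : {y : Rn n | (t : ℝ≥0∞) < (u y).abs} = ⋃ k, {y | (x k : ℝ≥0∞) < (u y).abs} := by
    ext y
    simp only [mem_ofPred_eq, mem_iUnion]
    constructor
    · intro hy
      exact ((ENNReal.tendsto_coe.2 hx).eventually_lt_const hy).exists
    · rintro ⟨k, hk⟩
      exact lt_trans (ENNReal.coe_lt_coe.2 (hxt k)) hk
  have hmono : Monotone fun k => {y : Rn n | (x k : ℝ≥0∞) < (u y).abs} :=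
    fun i j hij y hy => lt_of_le_of_lt (ENNReal.coe_le_coe.2 (hxm.antitone hij)) hy
  rw [distribution, hU, hmono.measure_iUnion]
  exact iSup_le fun k => h _ (hxt k)

/-- The rearrangement and the distribution function are generalized inverses of each other. -/
theorem rearrangement_le_iff {u : Rn n → EReal} {s : ℝ} {t : ℝ≥0} :
    rearrangement u s ≤ t ↔ distribution u t ≤ ENNReal.ofReal s := by
  constructor
  · intro h
    refine distribution_le_of_forall_gt fun t' ht' => ?_
    have hlt : rearrangement u s < t' := lt_of_le_of_lt h (ENNReal.coe_lt_coe.2 ht')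
    simp only [rearrangement, iInf_lt_iff] at hlt
    obtain ⟨r, hr, hrt⟩ := hlt
    exact (distribution_antitone u (ENNReal.coe_lt_coe.1 hrt).le).trans hr
  · intro h
    exact iInf₂_le t h

theorem rearrangement_antitone (u : Rn n → EReal) : Antitone (rearrangement u) :=
  fun _ _ h => iInf_mono fun _ => iInf_mono' fun ht =>
    ⟨ht.trans (ENNReal.ofReal_le_ofReal h), le_rfl⟩

/-- The integral of the rearrangement over `(0, s)` depends on `u` only through its distribution
function. This is what makes every norm computation possible without handling `u*` itself. -/
theorem lintegral_rearrangement (u : Rn n → EReal) (s : ℝ) :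
    ∫⁻ t in Ioo (0 : ℝ) s, rearrangement u t =
      ∫⁻ l in Ioi (0 : ℝ), min (ENNReal.ofReal s) (distribution u l.toNNReal) := by
  rw [lintegral_eq_lintegral_measure_ofReal_lt (rearrangement_antitone u).measurable.aemeasurable]
  refine lintegral_congr fun l => ?_
  rw [Measure.restrict_apply
    (measurableSet_lt measurable_const (rearrangement_antitone u).measurable)]
  have hlt : ∀ t : ℝ, ENNReal.ofReal l < rearrangement u t ↔
      ENNReal.ofReal t < distribution u l.toNNReal := fun t => by
    rw [← not_le, ← not_le]
    exact not_congr rearrangement_le_iff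
  simp only [hlt]
  rcases le_or_gt (ENNReal.ofReal s) (distribution u l.toNNReal) with h | h
  · rw [min_eq_left h]
    have : {t : ℝ | ENNReal.ofReal t < distribution u l.toNNReal} ∩ Ioo 0 s = Ioo 0 s := by
      refine inter_eq_right.2 fun t ht => ?_
      exact ((ENNReal.ofReal_lt_ofReal_iff (ht.1.trans ht.2)).2 ht.2).trans_le h
    rw [this, Real.volume_Ioo, sub_zero]
  · rw [min_eq_right h.le]
    have hfin : distribution u l.toNNReal ≠ ∞ := (h.trans_le le_top).ne
    have : {t : ℝ | ENNReal.ofReal t < distribution u l.toNNReal} ∩ Ioo 0 s =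
        Ioo 0 (distribution u l.toNNReal).toReal := by
      ext t
      simp only [mem_inter_iff, mem_ofPred_eq, mem_Ioo]
      constructor
      · rintro ⟨h1, h2, -⟩
        exact ⟨h2, (ENNReal.ofReal_lt_iff_lt_toReal h2.le hfin).1 h1⟩
      · rintro ⟨h1, h2⟩
        have h3 := (ENNReal.ofReal_lt_iff_lt_toReal h1.le hfin).2 h2
        exact ⟨h3, h1, (ENNReal.ofReal_lt_ofReal_iff'.1 (h3.trans h)).1⟩
    rw [this, Real.volume_Ioo, sub_zero, ENNReal.ofReal_toReal hfin]

theorem lebesgueOneNorm_eq_lintegral_distribution {u : Rn n → EReal} (hu : AEMeasurable u) :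
    lebesgueOneNorm n u = ∫⁻ l in Ioi (0 : ℝ), distribution u l.toNNReal :=
  lintegral_eq_lintegral_measure_ofReal_lt (measurable_abs.comp_aemeasurable hu)

/-! ### Bounds for the Marcinkiewicz norm -/

theorem marcinkiewiczNorm_eq (φ : ℝ → ℝ) (u : Rn n → EReal) :
    marcinkiewiczNorm n φ u = ⨆ s ∈ Ioi (0 : ℝ), (ENNReal.ofReal s)⁻¹ *
      (∫⁻ l in Ioi (0 : ℝ), min (ENNReal.ofReal s) (distribution u l.toNNReal)) *
        ENNReal.ofReal (φ s) := by
  simp only [marcinkiewiczNorm, maximalRearrangement, lintegral_rearrangement]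

theorem marcinkiewiczNorm_mono (φ : ℝ → ℝ) {u v : Rn n → EReal}
    (h : ∀ y, (u y).abs ≤ (v y).abs) : marcinkiewiczNorm n φ u ≤ marcinkiewiczNorm n φ v := by
  simp only [marcinkiewiczNorm_eq]
  gcongr with s hs l
  exact distribution_mono h _

theorem lebesgueOneNorm_mono {u v : Rn n → EReal} (h : ∀ y, (u y).abs ≤ (v y).abs) :
    lebesgueOneNorm n u ≤ lebesgueOneNorm n v :=
  lintegral_mono h

theorem le_marcinkiewiczNorm {φ : ℝ → ℝ} {u : Rn n → EReal} {s a : ℝ} (hs : 0 < s)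
    (h : ∀ l : ℝ, 0 < l → l < a → ENNReal.ofReal s ≤ distribution u l.toNNReal) :
    ENNReal.ofReal a * ENNReal.ofReal (φ s) ≤ marcinkiewiczNorm n φ u := by
  rw [marcinkiewiczNorm_eq]
  refine le_trans ?_ (le_iSup₂ (α := ℝ≥0∞) s hs)
  gcongr
  have hs' : ENNReal.ofReal s ≠ 0 := (ENNReal.ofReal_pos.2 hs).ne'
  calc ENNReal.ofReal a = (ENNReal.ofReal s)⁻¹ * (ENNReal.ofReal s * ENNReal.ofReal a) := by
        rw [← mul_assoc, ENNReal.inv_mul_cancel hs' ENNReal.ofReal_ne_top, one_mul]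
    _ = (ENNReal.ofReal s)⁻¹ * ∫⁻ _ in Ioo (0 : ℝ) a, ENNReal.ofReal s := by
        rw [setLIntegral_const, Real.volume_Ioo, sub_zero]
    _ ≤ (ENNReal.ofReal s)⁻¹ * ∫⁻ l in Ioo (0 : ℝ) a,
          min (ENNReal.ofReal s) (distribution u l.toNNReal) := by
        gcongr 1
        exact setLIntegral_mono' measurableSet_Ioo fun l hl => le_min le_rfl (h l hl.1 hl.2)
    _ ≤ _ := by
        gcongr 1
        exact lintegral_mono_set Ioo_subset_Ioi_self

/-- If `s / φ s` is bounded below by `L > 0`, then the Marcinkiewicz norm is at most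
`L⁻¹` times the `L¹` norm, here written through the distribution function. -/
theorem marcinkiewiczNorm_le_lintegral_distribution {φ : ℝ → ℝ} {L : ℝ} (hL : 0 < L)
    (hpos : ∀ s, 0 < s → 0 < φ s) (h : ∀ s, 0 < s → L ≤ s / φ s) (u : Rn n → EReal) :
    marcinkiewiczNorm n φ u ≤
      ENNReal.ofReal L⁻¹ * ∫⁻ l in Ioi (0 : ℝ), distribution u l.toNNReal := by
  rw [marcinkiewiczNorm_eq]
  refine iSup₂_le fun s hs => ?_
  have hs : 0 < s := hs
  calc _ = (ENNReal.ofReal s)⁻¹ * ENNReal.ofReal (φ s) *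
        ∫⁻ l in Ioi (0 : ℝ), min (ENNReal.ofReal s) (distribution u l.toNNReal) := by ring
    _ ≤ _ := by
      gcongr
      · rw [← ENNReal.ofReal_inv_of_pos hs, ← ENNReal.ofReal_mul (by positivity)]
        refine ENNReal.ofReal_le_ofReal ?_
        have := h s hs
        rw [le_div_iff₀ (hpos s hs)] at this
        rw [inv_mul_le_iff₀ hs, ← div_eq_mul_inv, le_div_iff₀ hL]
        linarith
      · exact min_le_right _ _

/-- On functions supported in a set of finite measure, finiteness of the Marcinkiewicz norm
forces integrability: test the supremum at the measure of the support. -/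
theorem lebesgueOneNorm_indicator_lt_top {φ : ℝ → ℝ} (hpos : ∀ s, 0 < s → 0 < φ s)
    {u : Rn n → EReal} {K : Set (Rn n)} (hu : AEMeasurable u) (hK : NullMeasurableSet K)
    (hKfin : volume K ≠ ∞) (h : marcinkiewiczNorm n φ (K.indicator u) < ∞) :
    lebesgueOneNorm n (K.indicator u) < ∞ := by
  rw [lebesgueOneNorm_eq_lintegral_distribution (hu.indicator₀ hK)]
  set s := (volume K).toReal + 1
  have hs : 0 < s := by positivity
  have hdist : ∀ t, distribution (K.indicator u) t ≤ ENNReal.ofReal s := fun t => by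
    have hsub : {y : Rn n | (t : ℝ≥0∞) < (K.indicator u y).abs} ⊆ K := by
      intro y hy
      by_contra hyK
      simp [hyK] at hy
    refine (measure_mono hsub).trans ?_
    rw [← ENNReal.ofReal_toReal hKfin]
    exact ENNReal.ofReal_le_ofReal (by simp [s])
  rw [marcinkiewiczNorm_eq] at h
  have h' := lt_of_le_of_lt (le_iSup₂ (α := ℝ≥0∞) s hs) h
  simp only [min_eq_right (hdist _)] at h'
  by_contra htop
  rw [not_lt, top_le_iff] at htop
  rw [htop, ENNReal.mul_top (by simp), ENNReal.top_mul
    (ENNReal.ofReal_pos.2 (hpos s hs)).ne'] at h'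
  exact lt_irrefl _ h'

theorem localSpace_marcinkiewicz_subset {φ : ℝ → ℝ} (hpos : ∀ s, 0 < s → 0 < φ s) :
    localSpace (marcinkiewiczNorm n φ) ⊆ localSpace (lebesgueOneNorm n) :=
  fun _ hu => ⟨hu.1, fun K hK hKm =>
    lebesgueOneNorm_indicator_lt_top hpos hu.1 hKm hK.measure_lt_top.ne (hu.2 K hK hKm)⟩

theorem localSpace_lebesgueOne_subset {φ : ℝ → ℝ} {L : ℝ} (hL : 0 < L)
    (hpos : ∀ s, 0 < s → 0 < φ s) (h : ∀ s, 0 < s → L ≤ s / φ s) :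
    localSpace (lebesgueOneNorm n) ⊆ localSpace (marcinkiewiczNorm n φ) := by
  refine fun u hu => ⟨hu.1, fun K hK hKm => ?_⟩
  refine lt_of_le_of_lt (marcinkiewiczNorm_le_lintegral_distribution hL hpos h _) ?_
  rw [← lebesgueOneNorm_eq_lintegral_distribution (hu.1.indicator₀ hKm)]
  exact ENNReal.mul_lt_top ENNReal.ofReal_lt_top (hu.2 K hK hKm)

/-! ### Averaged norms and Lebesgue's differentiation theorem -/

theorem nontrivial_Rn (hn : 1 ≤ n) : Nontrivial (Rn n) :=
  Module.nontrivial_of_finrank_pos (R := ℝ) (by rw [finrank_euclideanSpace_fin]; omega)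

/-- Rescaling by `ℒⁿ(G)^{1/n}` divides the distribution function by `ℒⁿ(G)`; no measurability is
needed. -/
theorem distribution_averaged (hn : 1 ≤ n) {G : Set (Rn n)} (hG0 : volume G ≠ 0)
    (hG : volume G ≠ ∞) (u : Rn n → EReal) (t : ℝ≥0) :
    distribution (fun y => G.indicator u ((volume.real G ^ (1 / (n : ℝ))) • y)) t =
      (volume G)⁻¹ * distribution (G.indicator u) t := by
  have hpos : 0 < volume.real G := ENNReal.toReal_pos hG0 hG
  have hc : (volume.real G ^ (1 / (n : ℝ))) ^ n = volume.real G := by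
    rw [one_div]
    exact Real.rpow_inv_natCast_pow hpos.le (by omega)
  have h := Measure.addHaar_preimage_smul (volume : Measure (Rn n))
    (Real.rpow_pos_of_pos hpos (1 / (n : ℝ))).ne' {y | (t : ℝ≥0∞) < (G.indicator u y).abs}
  rw [finrank_euclideanSpace_fin, hc, abs_of_pos (inv_pos.2 hpos),
    ENNReal.ofReal_inv_of_pos hpos, measureReal_def, ENNReal.ofReal_toReal hG] at h
  exact h

theorem ae_abs_lt_top_of_mem_localSpace {u : Rn n → EReal}
    (hu : u ∈ localSpace (lebesgueOneNorm n)) : ∀ᵐ y, (u y).abs < ∞ := by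
  have h : ∀ k : ℕ, ∀ᵐ y, ((Metric.ball (0 : Rn n) k).indicator u y).abs < ∞ := fun k =>
    ae_lt_top' (measurable_abs.comp_aemeasurable (hu.1.indicator measurableSet_ball))
      (hu.2 _ Metric.isBounded_ball measurableSet_ball.nullMeasurableSet).ne
  filter_upwards [ae_all_iff.2 h] with y hy
  obtain ⟨k, hk⟩ := exists_nat_gt (dist y 0)
  simpa [indicator_of_mem (Metric.mem_ball.2 hk)] using hy k

theorem enorm_toReal_le_abs (x : EReal) : ‖x.toReal‖ₑ ≤ x.abs := by
  induction x with
  | bot => simp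
  | top => simp
  | coe x => simp [EReal.abs_def, Real.enorm_eq_ofReal_abs]

theorem coe_toReal_of_abs_lt_top {x : EReal} (h : x.abs < ∞) : (x.toReal : EReal) = x := by
  induction x with
  | bot => simp at h
  | top => simp at h
  | coe x => simp

theorem locallyIntegrable_toReal {u : Rn n → EReal}
    (hu : u ∈ localSpace (lebesgueOneNorm n)) : LocallyIntegrable fun y => (u y).toReal := by
  intro x
  refine ⟨Metric.ball x 1, Metric.ball_mem_nhds x one_pos,
    (measurable_ereal_toReal.comp_aemeasurable hu.1).aestronglyMeasurable.restrict, ?_⟩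
  refine lt_of_le_of_lt (lintegral_mono fun y => enorm_toReal_le_abs (u y)) ?_
  rw [← lintegral_indicator measurableSet_ball]
  refine lt_of_eq_of_lt (lintegral_congr fun y => ?_)
    (hu.2 (Metric.ball x 1) Metric.isBounded_ball measurableSet_ball.nullMeasurableSet)
  by_cases hy : y ∈ Metric.ball x 1 <;> simp [hy]

/-- If `s / φ s` is bounded below, the averaged Marcinkiewicz norm over a ball is dominated by the
`L¹` average over it, so that Lebesgue's differentiation theorem applies. -/
theorem lebesguePointProperty_of_pos (hn : 1 ≤ n) {φ : ℝ → ℝ} {L : ℝ} (hL : 0 < L)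
    (hpos : ∀ s, 0 < s → 0 < φ s) (h : ∀ s, 0 < s → L ≤ s / φ s) :
    LebesguePointProperty (marcinkiewiczNorm n φ) := by
  have := nontrivial_Rn hn
  intro u hu
  replace hu := localSpace_marcinkiewicz_subset hpos hu
  have hfin := ae_abs_lt_top_of_mem_localSpace hu
  have hdiff := (Besicovitch.vitaliFamily
    (volume : Measure (Rn n))).ae_tendsto_lintegral_enorm_sub_div (locallyIntegrable_toReal hu)
  filter_upwards [hdiff, hfin] with x hx hux
  have hlim := ENNReal.Tendsto.const_mul (a := ENNReal.ofReal L⁻¹)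
    (hx.comp (Besicovitch.tendsto_filterAt volume x)) (Or.inr ENNReal.ofReal_ne_top)
  rw [mul_zero] at hlim
  refine tendsto_of_tendsto_of_tendsto_of_le_of_le' tendsto_const_nhds hlim
    (Eventually.of_forall fun _ => zero_le) ?_
  filter_upwards [self_mem_nhdsWithin] with r hr
  have hB0 : volume (Metric.ball x r) ≠ 0 := (Metric.measure_ball_pos volume x hr).ne'
  have hae : (fun y => u y - u x) =ᵐ[volume]
      fun y => (((u y).toReal - (u x).toReal : ℝ) : EReal) := by
    filter_upwards [hfin] with y hy
    rw [EReal.coe_sub, coe_toReal_of_abs_lt_top hy, coe_toReal_of_abs_lt_top hux]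
  have hmeas : AEMeasurable fun y => u y - u x :=
    (measurable_coe_real_ereal.comp_aemeasurable
      ((measurable_ereal_toReal.comp_aemeasurable hu.1).sub_const _)).congr hae.symm
  refine (marcinkiewiczNorm_le_lintegral_distribution hL hpos h _).trans ?_
  simp only [distribution_averaged hn hB0 measure_ball_lt_top.ne]
  rw [lintegral_const_mul' _ _ (ENNReal.inv_ne_top.2 hB0),
    ← lebesgueOneNorm_eq_lintegral_distribution (hmeas.indicator measurableSet_ball)]
  simp only [Function.comp_apply]
  rw [ENNReal.div_eq_inv_mul, Measure.addHaar_closedBall_eq_addHaar_ball]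
  gcongr
  calc lebesgueOneNorm n ((Metric.ball x r).indicator fun y => u y - u x)
      = ∫⁻ y in Metric.ball x r, (u y - u x).abs := by
        rw [← lintegral_indicator measurableSet_ball]
        refine lintegral_congr fun y => ?_
        by_cases hy : y ∈ Metric.ball x r <;> simp [hy]
    _ = ∫⁻ y in Metric.ball x r, ‖(u y).toReal - (u x).toReal‖ₑ := by
        refine lintegral_congr_ae (ae_restrict_of_ae ?_)
        filter_upwards [hae] with y hy
        rw [hy, EReal.abs_def, Real.enorm_eq_ofReal_abs]
    _ ≤ _ := lintegral_mono_set Metric.ball_subset_closedBall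

theorem abs_indicator_le (K : Set (Rn n)) (u : Rn n → EReal) (y : Rn n) :
    (K.indicator u y).abs ≤ (u y).abs := by
  by_cases hy : y ∈ K <;> simp [hy]

/-! ### Suprema of multiples of characteristic functions -/

/-- The function `sup_k a_k χ_{E_k}`. The values `a_k` are meant to be nonnegative: negative ones
count as zero. -/
noncomputable def levelSup (E : ℕ → Set (Rn n)) (a : ℕ → ℝ) (y : Rn n) : EReal :=
  ((⨆ k, (E k).indicator (fun _ => ENNReal.ofReal (a k)) y : ℝ≥0∞) : EReal)

theorem abs_coe_ennreal (x : ℝ≥0∞) : (x : EReal).abs = x := by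
  induction x with
  | top => simp
  | coe x =>
    change ((x : ℝ) : EReal).abs = _
    rw [EReal.abs_def]
    simp

section LevelSup

variable {E : ℕ → Set (Rn n)} {a : ℕ → ℝ}

theorem abs_levelSup (y : Rn n) :
    (levelSup E a y).abs = ⨆ k, (E k).indicator (fun _ => ENNReal.ofReal (a k)) y :=
  abs_coe_ennreal _

theorem measurable_levelSup (hE : ∀ k, MeasurableSet (E k)) : Measurable (levelSup E a) :=
  measurable_coe_ennreal_ereal.comp
    (Measurable.iSup fun k => measurable_const.indicator (hE k))

theorem levelSup_eq_zero {y : Rn n} (hy : ∀ k, y ∉ E k) : levelSup E a y = 0 := by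
  simp [levelSup, hy]

theorem lt_abs_levelSup {y : Rn n} {l : ℝ} {k : ℕ} (hy : y ∈ E k) (h0 : 0 < l) (h : l < a k) :
    (l.toNNReal : ℝ≥0∞) < (levelSup E a y).abs := by
  rw [abs_levelSup]
  refine lt_of_lt_of_le ?_ (le_iSup _ k)
  rw [indicator_of_mem hy]
  exact (ENNReal.ofReal_lt_ofReal_iff (h0.trans h)).2 h

theorem distribution_levelSup_le (t : ℝ) :
    distribution (levelSup E a) t.toNNReal ≤
      ∑' k, (Iio (a k)).indicator (fun _ => volume (E k)) t := by
  have hsub : {y : Rn n | (t.toNNReal : ℝ≥0∞) < (levelSup E a y).abs} ⊆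
      ⋃ k, {y | t < a k ∧ y ∈ E k} := by
    intro y hy
    rw [mem_ofPred_eq, abs_levelSup, lt_iSup_iff] at hy
    obtain ⟨k, hk⟩ := hy
    by_cases hyk : y ∈ E k
    · rw [indicator_of_mem hyk] at hk
      exact mem_iUnion.2 ⟨k, (ENNReal.ofReal_lt_ofReal_iff'.1 hk).1, hyk⟩
    · rw [indicator_of_notMem hyk] at hk
      exact absurd hk not_lt_zero
  refine (measure_mono hsub).trans ((measure_iUnion_le _).trans (ENNReal.tsum_le_tsum fun k => ?_))
  by_cases h : t < a k
  · rw [indicator_of_mem (mem_Iio.2 h)]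
    exact measure_mono fun y hy => hy.2
  · simp [h]

theorem lebesgueOneNorm_levelSup_le (hE : ∀ k, MeasurableSet (E k)) :
    lebesgueOneNorm n (levelSup E a) ≤ ∑' k, ENNReal.ofReal (a k) * volume (E k) := by
  calc lebesgueOneNorm n (levelSup E a)
      ≤ ∫⁻ y, ∑' k, (E k).indicator (fun _ => ENNReal.ofReal (a k)) y := by
        refine lintegral_mono fun y => ?_
        rw [abs_levelSup]
        exact iSup_le fun k => ENNReal.le_tsum k
    _ = _ := by
        rw [lintegral_tsum fun k => (measurable_const.indicator (hE k)).aemeasurable]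
        exact tsum_congr fun k => lintegral_indicator_const (hE k) _

/-- Cutting at the height `b` bounds the integral of the rearrangement of `sup_k a_k χ_{E_k}` over
`(0, s)`: below `b` the distribution function is replaced by `s`, and above `b` only the sets
`E_k` with `k ≥ m` are seen. -/
theorem lintegral_min_distribution_levelSup_le {b : ℝ} (m : ℕ) (hb : ∀ i < m, a i ≤ b) (s : ℝ≥0∞) :
    ∫⁻ l in Ioi (0 : ℝ), min s (distribution (levelSup E a) l.toNNReal) ≤
      s * ENNReal.ofReal b +
        ∑' j, ENNReal.ofReal (a (m + j)) * volume (E (m + j)) := by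
  have hpt : ∀ l : ℝ, min s (distribution (levelSup E a) l.toNNReal) ≤
      (Iio b).indicator (fun _ => s) l +
        ∑' j, (Iio (a (m + j))).indicator (fun _ => volume (E (m + j))) l := by
    intro l
    rcases lt_or_ge l b with h | h
    · rw [indicator_of_mem (mem_Iio.2 h)]
      exact (min_le_left _ _).trans le_self_add
    · refine (min_le_right _ _).trans ((distribution_levelSup_le l).trans ?_)
      have hz : ∑ i ∈ Finset.range m, (Iio (a i)).indicator (fun _ => volume (E i)) l = 0 :=
        Finset.sum_eq_zero fun i hi =>
          indicator_of_notMem (s := Iio (a i))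
            (fun h' => absurd h' (not_lt.2 ((hb i (Finset.mem_range.1 hi)).trans h))) _
      have hsplit := Summable.sum_add_tsum_nat_add' (k := m)
        (f := fun i => (Iio (a i)).indicator (fun _ => volume (E i)) l) ENNReal.summable
      rw [hz, zero_add] at hsplit
      rw [← hsplit]
      simp_rw [add_comm m]
      exact le_add_self
  have hI : ∀ (c : ℝ) (w : ℝ≥0∞), ∫⁻ l in Ioi (0 : ℝ), (Iio c).indicator (fun _ => w) l =
      w * ENNReal.ofReal c := by
    intro c w
    rw [lintegral_indicator_const measurableSet_Iio, Measure.restrict_apply measurableSet_Iio,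
      inter_comm, Ioi_inter_Iio, Real.volume_Ioo, sub_zero]
  refine (lintegral_mono hpt).trans (le_of_eq ?_)
  rw [lintegral_add_left (measurable_const.indicator measurableSet_Iio), hI,
    lintegral_tsum fun j => (measurable_const.indicator measurableSet_Iio).aemeasurable]
  simp_rw [hI, mul_comm]

end LevelSup

/-! ### Rapidly decreasing scales -/

/-- If `s / φ s` tends to zero, there are scales `δ k` along which it decreases geometrically. -/
theorem exists_scales {φ : ℝ → ℝ} (hpos : ∀ s, 0 < s → 0 < φ s)
    (hlim : Tendsto (fun s : ℝ => s / φ s) (𝓝[>] 0) (𝓝 0)) {ε : ℝ} (hε : 0 < ε) :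
    ∃ δ : ℕ → ℝ, (∀ k, 0 < δ k) ∧ δ 0 = ε ∧ (∀ k, δ (k + 1) ≤ 1 / 2 * δ k) ∧
      ∀ k, δ (k + 1) / φ (δ (k + 1)) ≤ 1 / 4 * (δ k / φ (δ k)) := by
  have hstep : ∀ d : {d : ℝ // 0 < d}, ∃ d' : {d : ℝ // 0 < d},
      (d' : ℝ) ≤ 1 / 2 * d ∧ (d' : ℝ) / φ d' ≤ 1 / 4 * (d / φ d) := by
    rintro ⟨d, hd⟩
    have hq : 0 < 1 / 4 * (d / φ d) := by have := hpos d hd; positivity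
    have h1 := hlim.eventually_le_const hq
    have h2 : ∀ᶠ s : ℝ in 𝓝[>] 0, s ≤ 1 / 2 * d :=
      (tendsto_nhdsWithin_of_tendsto_nhds tendsto_id).eventually_le_const (by positivity)
    obtain ⟨s, ⟨h1, h2⟩, hs⟩ := ((h1.and h2).and self_mem_nhdsWithin).exists
    exact ⟨⟨s, hs⟩, h2, h1⟩
  choose f hf1 hf2 using hstep
  refine ⟨fun k => (f^[k] ⟨ε, hε⟩ : {d : ℝ // 0 < d}), fun k => (f^[k] ⟨ε, hε⟩).2, rfl,
    fun k => ?_, fun k => ?_⟩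
  · simp only [Function.iterate_succ_apply']
    exact hf1 _
  · simp only [Function.iterate_succ_apply']
    exact hf2 _

theorem le_pow_mul_of_succ_le {g : ℕ → ℝ} {c : ℝ} (hc : 0 ≤ c) (h : ∀ k, g (k + 1) ≤ c * g k)
    (m j : ℕ) : g (m + j) ≤ c ^ j * g m := by
  induction j with
  | zero => simp
  | succ j ih =>
    calc g (m + (j + 1)) ≤ c * g (m + j) := h _
      _ ≤ c * (c ^ j * g m) := by gcongr
      _ = c ^ (j + 1) * g m := by ring

theorem tsum_ofReal_le_two_mul {f : ℕ → ℝ} {A : ℝ} (h : ∀ j, f j ≤ (1 / 2) ^ j * A) :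
    ∑' j, ENNReal.ofReal (f j) ≤ 2 * ENNReal.ofReal A := by
  calc ∑' j, ENNReal.ofReal (f j) ≤ ∑' j, (2⁻¹ : ℝ≥0∞) ^ j * ENNReal.ofReal A := by
        refine ENNReal.tsum_le_tsum fun j => (ENNReal.ofReal_le_ofReal (h j)).trans (le_of_eq ?_)
        rw [ENNReal.ofReal_mul (by positivity), ENNReal.ofReal_pow (by norm_num), one_div,
          ENNReal.ofReal_inv_of_pos two_pos, ENNReal.ofReal_ofNat]
    _ = 2 * ENNReal.ofReal A := by
        rw [ENNReal.tsum_mul_right, ENNReal.tsum_geometric, ENNReal.one_sub_inv_two, inv_inv]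

/-! ### An integrable function outside the Marcinkiewicz space -/

theorem volume_closedBall_eq (hn : 1 ≤ n) (x : Rn n) {r : ℝ} (hr : 0 ≤ r) :
    volume (Metric.closedBall x r) =
      ENNReal.ofReal (r ^ n) * volume (Metric.ball (0 : Rn n) 1) := by
  have := nontrivial_Rn hn
  rw [Measure.addHaar_closedBall_eq_addHaar_ball, Measure.addHaar_ball _ _ hr,
    finrank_euclideanSpace_fin]

theorem exists_pow_eq (hn : 1 ≤ n) {d : ℝ} (hd : 0 ≤ d) : ∃ ρ : ℝ, 0 ≤ ρ ∧ ρ ^ n = d :=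
  ⟨d ^ (n : ℝ)⁻¹, Real.rpow_nonneg hd _, Real.rpow_inv_natCast_pow hd (by omega)⟩

/-- If `s / φ s → 0`, the heights `2 ^ k / φ (δ k)` on concentric balls of volume comparable to
`δ k` give an integrable function of infinite Marcinkiewicz norm. -/
theorem localSpace_ne_of_tendsto_zero (hn : 1 ≤ n) {φ : ℝ → ℝ}
    (hφ : ConcaveOn ℝ (Ici 0) φ) (h0 : ∀ s, 0 ≤ s → 0 ≤ φ s) (hpos : ∀ s, 0 < s → 0 < φ s)
    (hlim : Tendsto (fun s : ℝ => s / φ s) (𝓝[>] 0) (𝓝 0)) :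
    localSpace (marcinkiewiczNorm n φ) ≠ localSpace (lebesgueOneNorm n) := by
  obtain ⟨δ, hδ, hδ0, hδ2, hδ4⟩ := exists_scales hpos hlim one_pos
  choose ρ hρ0 hρ using fun k => exists_pow_eq hn (hδ k).le
  have hδ1 : ∀ k, δ k ≤ 1 := by
    intro k
    have := le_pow_mul_of_succ_le (by norm_num) hδ2 0 k
    rw [zero_add, hδ0, mul_one] at this
    exact this.trans (pow_le_one₀ (by norm_num) (by norm_num))
  have hρ1 : ∀ k, ρ k ≤ 1 := fun k => by
    by_contra! h
    exact absurd (hδ1 k) (not_le.2 (by rw [← hρ k]; exact one_lt_pow₀ h (by omega)))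
  set E : ℕ → Set (Rn n) := fun k => Metric.closedBall 0 (ρ k)
  set a : ℕ → ℝ := fun k => 2 ^ k / φ (δ k)
  set V := volume (Metric.ball (0 : Rn n) 1)
  have hV0 : 0 < V := Metric.measure_ball_pos volume _ one_pos
  have hVfin : V ≠ ∞ := measure_ball_lt_top.ne
  have hE : ∀ k, MeasurableSet (E k) := fun k => measurableSet_closedBall
  have hvol : ∀ k, volume (E k) = ENNReal.ofReal (δ k) * V := fun k => by
    rw [volume_closedBall_eq hn _ (hρ0 k), hρ]
  have hsum : ∑' k, ENNReal.ofReal (a k) * volume (E k) < ∞ := by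
    calc ∑' k, ENNReal.ofReal (a k) * volume (E k)
        = (∑' k, ENNReal.ofReal (a k * δ k)) * V := by
          rw [← ENNReal.tsum_mul_right]
          refine tsum_congr fun k => ?_
          rw [hvol, ← mul_assoc,
            ENNReal.ofReal_mul (div_nonneg (by positivity) (hpos _ (hδ k)).le)]
      _ ≤ 2 * ENNReal.ofReal (δ 0 / φ (δ 0)) * V := by
          gcongr
          refine tsum_ofReal_le_two_mul fun k => ?_
          have := le_pow_mul_of_succ_le (g := fun k => δ k / φ (δ k)) (by norm_num) hδ4 0 k
          rw [zero_add] at this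
          calc a k * δ k = 2 ^ k * (δ k / φ (δ k)) := by simp only [a]; ring
            _ ≤ 2 ^ k * ((1 / 4) ^ k * (δ 0 / φ (δ 0))) := by gcongr
            _ = (1 / 2) ^ k * (δ 0 / φ (δ 0)) := by
              rw [← mul_assoc, ← mul_pow]; norm_num
      _ < ∞ := by finiteness
  have hmem : levelSup E a ∈ localSpace (lebesgueOneNorm n) := by
    refine ⟨(measurable_levelSup hE).aemeasurable, fun K _ _ => ?_⟩
    exact lt_of_le_of_lt ((lebesgueOneNorm_mono fun y => abs_indicator_le K _ y).trans
      (lebesgueOneNorm_levelSup_le hE)) hsum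
  intro heq
  rw [← heq] at hmem
  have hfin := hmem.2 (Metric.closedBall 0 1) Metric.isBounded_closedBall
    measurableSet_closedBall.nullMeasurableSet
  set c : ℝ := min 1 V.toReal
  have hc : 0 < c := lt_min one_pos (ENNReal.toReal_pos hV0.ne' hVfin)
  have hle : ∀ k : ℕ, ENNReal.ofReal (c * 2 ^ k) ≤
      marcinkiewiczNorm n φ ((Metric.closedBall 0 1).indicator (levelSup E a)) := by
    intro k
    have hcδ : 0 < c * δ k := mul_pos hc (hδ k)
    have hak : 0 ≤ a k := div_nonneg (by positivity) (hpos _ (hδ k)).le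
    refine le_trans ?_ (le_marcinkiewiczNorm (φ := φ) (s := c * δ k) (a := a k) hcδ ?_)
    · rw [← ENNReal.ofReal_mul hak]
      refine ENNReal.ofReal_le_ofReal ?_
      have h1 := hφ.mul_le_map_mul h0 hc.le (min_le_left _ _) (hδ k).le
      calc c * 2 ^ k = a k * (c * φ (δ k)) := by
            have := (hpos _ (hδ k)).ne'
            simp only [a]; field_simp
        _ ≤ _ := by gcongr
    · intro l hl hla
      calc ENNReal.ofReal (c * δ k) ≤ ENNReal.ofReal (δ k) * V := by
            rw [mul_comm, ENNReal.ofReal_mul (hδ k).le]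
            gcongr
            exact ENNReal.ofReal_le_of_le_toReal (min_le_right _ _)
        _ = volume (E k) := (hvol k).symm
        _ ≤ _ := measure_mono fun y hy => by
            have hy1 : y ∈ Metric.closedBall (0 : Rn n) 1 :=
              Metric.closedBall_subset_closedBall (hρ1 k) hy
            rw [mem_ofPred_eq, indicator_of_mem hy1]
            exact lt_abs_levelSup hy hl hla
  obtain ⟨k, hk⟩ := pow_unbounded_of_one_lt
    ((marcinkiewiczNorm n φ ((Metric.closedBall 0 1).indicator (levelSup E a))).toReal / c)
    one_lt_two
  rw [div_lt_iff₀' hc] at hk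
  have := ENNReal.toReal_mono hfin.ne (hle k)
  rw [ENNReal.toReal_ofReal (by positivity)] at this
  linarith

/-! ### Failure of the Lebesgue point property -/

/-- A set of measure at most a constant times `d` which is seen with density comparable to `d`
from every point of the unit ball at the scale `7 r`: small balls around the centres of a
Vitali family of balls of radius `r`. -/
theorem exists_small_spread_set (hn : 1 ≤ n) {d r : ℝ} (hd : 0 ≤ d) (hd1 : d ≤ 1) (hr : 0 < r)
    (hr1 : r ≤ 1) :
    ∃ E : Set (Rn n), MeasurableSet E ∧
      volume E ≤ ENNReal.ofReal d *
        (ENNReal.ofReal (2 ^ n) * volume (Metric.ball (0 : Rn n) 1)) ∧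
      ∀ x ∈ Metric.ball (0 : Rn n) 1,
        ENNReal.ofReal (1 / 7 ^ n * d) * volume (Metric.ball x (7 * r)) ≤
          volume (E ∩ Metric.ball x (7 * r)) := by
  have := nontrivial_Rn hn
  obtain ⟨t, ht, hdisj, hcov⟩ := Vitali.exists_disjoint_subfamily_covering_enlargement_closedBall
    (Metric.ball (0 : Rn n) 1) id (fun _ => r) r (fun _ _ => le_rfl) 5 (by norm_num)
  obtain ⟨ρ, hρ0, hρ⟩ := exists_pow_eq hn (mul_nonneg hd (pow_nonneg hr.le n))
  simp only [id] at hdisj hcov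
  have htc : t.Countable := hdisj.countable_of_nonempty_interior fun x _ =>
    ⟨x, Metric.ball_subset_interior_closedBall (Metric.mem_ball_self hr)⟩
  have hρr : ρ ≤ r := by
    refine le_of_pow_le_pow_left₀ (by omega : n ≠ 0) hr.le ?_
    rw [hρ]
    exact mul_le_of_le_one_left (by positivity) hd1
  have hvol : ∀ x : Rn n, volume (Metric.closedBall x ρ) =
      ENNReal.ofReal d * volume (Metric.closedBall x r) := fun x => by
    rw [volume_closedBall_eq hn _ hρ0, volume_closedBall_eq hn _ hr.le, hρ,
      ENNReal.ofReal_mul hd, mul_assoc]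
  refine ⟨⋃ x ∈ t, Metric.closedBall x ρ,
    MeasurableSet.biUnion htc fun x _ => measurableSet_closedBall, ?_, ?_⟩
  · calc volume (⋃ x ∈ t, Metric.closedBall x ρ)
        ≤ ∑' x : t, volume (Metric.closedBall (x : Rn n) ρ) := measure_biUnion_le _ htc _
      _ = ENNReal.ofReal d * volume (⋃ x ∈ t, Metric.closedBall x r) := by
          rw [measure_biUnion htc hdisj fun x _ => measurableSet_closedBall,
            ← ENNReal.tsum_mul_left]
          simp_rw [hvol]
      _ ≤ ENNReal.ofReal d * volume (Metric.closedBall (0 : Rn n) 2) := by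
          gcongr
          refine iUnion₂_subset fun x hx => Metric.closedBall_subset_closedBall' ?_
          linarith [Metric.mem_ball.1 (ht hx)]
      _ = _ := by rw [volume_closedBall_eq hn _ two_pos.le]
  · intro x hx
    obtain ⟨z, hz, hsub⟩ := hcov x hx
    have hxz : dist z x ≤ 5 * r := by
      rw [dist_comm]
      exact hsub (Metric.mem_closedBall_self hr.le)
    have hzE : Metric.closedBall z ρ ⊆
        (⋃ x ∈ t, Metric.closedBall x ρ) ∩ Metric.ball x (7 * r) := by
      refine subset_inter (subset_biUnion_of_mem (u := fun x => Metric.closedBall x ρ) hz) ?_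
      intro y hy
      rw [Metric.mem_ball]
      linarith [dist_triangle y z x, Metric.mem_closedBall.1 hy]
    refine le_trans (le_of_eq ?_) (measure_mono hzE)
    rw [← Measure.addHaar_closedBall_eq_addHaar_ball, volume_closedBall_eq hn _ hρ0,
      volume_closedBall_eq hn _ (by positivity), hρ, ← mul_assoc,
      ← ENNReal.ofReal_mul (by positivity)]
    congr 2
    rw [mul_pow]
    field_simp

/-- The function `sup_k χ_{E_k} / φ (δ k)` has finite Marcinkiewicz norm when the sets `E k` have
measure at most a constant times `δ k` and `δ k / φ (δ k)` decreases geometrically. At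
`δ m ≤ s < δ (m - 1)`, the sets with index below `m` contribute at most `φ s / φ (δ (m - 1)) ≤ 1`,
and the others a geometric series whose leading term is bounded because `φ s / s` is at most
`φ (δ m) / δ m`. -/
theorem marcinkiewiczNorm_levelSup_le {φ : ℝ → ℝ} (hφ : ConcaveOn ℝ (Ici 0) φ)
    (h0 : ∀ s, 0 ≤ s → 0 ≤ φ s) (hpos : ∀ s, 0 < s → 0 < φ s) {δ : ℕ → ℝ} (hδ : ∀ k, 0 < δ k)
    (hδ2 : ∀ k, δ (k + 1) ≤ 1 / 2 * δ k)
    (hδ4 : ∀ k, δ (k + 1) / φ (δ (k + 1)) ≤ 1 / 4 * (δ k / φ (δ k)))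
    {E : ℕ → Set (Rn n)} {C : ℝ≥0∞} (hE : ∀ k, volume (E k) ≤ ENNReal.ofReal (δ k) * C) :
    marcinkiewiczNorm n φ (levelSup E fun k => 1 / φ (δ k)) ≤ 1 + 2 * C := by
  have hanti : Antitone δ := antitone_nat_of_succ_le fun k => (hδ2 k).trans (by linarith [hδ k])
  have hmonoφ := hφ.monotoneOn_Ici_of_nonneg h0
  rw [marcinkiewiczNorm_eq]
  refine iSup₂_le fun s hs => ?_
  have hs : 0 < s := hs
  have hex : ∃ m, δ m ≤ s := by
    have hlim : Tendsto (fun j : ℕ => (1 / 2 : ℝ) ^ j * δ 0) atTop (𝓝 (0 * δ 0)) :=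
      (tendsto_pow_atTop_nhds_zero_of_lt_one (by norm_num) (by norm_num)).mul_const _
    rw [zero_mul] at hlim
    obtain ⟨m, hm⟩ := (hlim.eventually_le_const hs).exists
    refine ⟨m, le_trans ?_ hm⟩
    simpa using le_pow_mul_of_succ_le (by norm_num) hδ2 0 m
  -- `m` is the scale of `s`: `δ m ≤ s < δ (m - 1)`, and `b = 1 / φ (δ (m - 1))` is the last height
  -- before it; if already `δ 0 ≤ s`, then `m = 0` and `b = 0`
  obtain ⟨m, b, hm, hb, hbs⟩ : ∃ (m : ℕ) (b : ℝ), δ m ≤ s ∧ (∀ i < m, 1 / φ (δ i) ≤ b) ∧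
      b * φ s ≤ 1 := by
    classical
    have hm := Nat.find_spec hex
    have hmin := fun i => Nat.find_min hex (m := i)
    rcases hcase : Nat.find hex with _ | p
    · exact ⟨0, 0, hcase ▸ hm, by simp, by simp⟩
    · refine ⟨p + 1, 1 / φ (δ p), hcase ▸ hm, fun i hi => ?_, ?_⟩
      · exact one_div_le_one_div_of_le (hpos _ (hδ p))
          (hmonoφ (hδ p).le (hδ i).le (hanti (Nat.lt_succ_iff.1 hi)))
      · rw [one_div_mul_eq_div, div_le_one (hpos _ (hδ p))]
        exact hmonoφ hs.le (hδ p).le (not_le.1 (hmin p (by omega))).le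
  have htail : ∑' j, ENNReal.ofReal (1 / φ (δ (m + j))) * volume (E (m + j)) ≤
      2 * ENNReal.ofReal (δ m / φ (δ m)) * C := by
    calc ∑' j, ENNReal.ofReal (1 / φ (δ (m + j))) * volume (E (m + j))
        ≤ ∑' j, ENNReal.ofReal (δ (m + j) / φ (δ (m + j))) * C := by
          refine ENNReal.tsum_le_tsum fun j => ?_
          calc _ ≤ ENNReal.ofReal (1 / φ (δ (m + j))) * (ENNReal.ofReal (δ (m + j)) * C) := by
                gcongr
                exact hE _
            _ = _ := by
                rw [← mul_assoc, ← ENNReal.ofReal_mul (one_div_nonneg.2 (hpos _ (hδ _)).le),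
                  one_div_mul_eq_div]
      _ ≤ _ := by
          rw [ENNReal.tsum_mul_right]
          gcongr
          refine tsum_ofReal_le_two_mul fun j => ?_
          have hg : 0 ≤ δ m / φ (δ m) := div_nonneg (hδ m).le (hpos _ (hδ m)).le
          refine (le_pow_mul_of_succ_le (g := fun k => δ k / φ (δ k)) (by norm_num)
            hδ4 m j).trans ?_
          gcongr
          norm_num
  have hs0 : ENNReal.ofReal s ≠ 0 := (ENNReal.ofReal_pos.2 hs).ne'
  calc _ ≤ (ENNReal.ofReal s)⁻¹ * (ENNReal.ofReal s * ENNReal.ofReal b +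
        2 * ENNReal.ofReal (δ m / φ (δ m)) * C) * ENNReal.ofReal (φ s) := by
        gcongr
        exact (lintegral_min_distribution_levelSup_le m hb _).trans (by gcongr)
    _ = (ENNReal.ofReal s)⁻¹ * ENNReal.ofReal s * (ENNReal.ofReal b * ENNReal.ofReal (φ s)) +
        2 * ((ENNReal.ofReal s)⁻¹ * ENNReal.ofReal (δ m / φ (δ m)) * ENNReal.ofReal (φ s)) * C := by
        ring
    _ ≤ 1 + 2 * 1 * C := by
        gcongr
        · rw [ENNReal.inv_mul_cancel hs0 ENNReal.ofReal_ne_top, one_mul,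
            ← ENNReal.ofReal_mul' (hpos s hs).le]
          exact ENNReal.ofReal_le_one.2 hbs
        · rw [← ENNReal.ofReal_inv_of_pos hs, ← ENNReal.ofReal_mul (by positivity),
            ← ENNReal.ofReal_mul' (hpos s hs).le]
          refine ENNReal.ofReal_le_one.2 ?_
          have h1 := hφ.mul_le_mul_of_le h0 (hδ m) hm
          have h2 := hpos _ (hδ m)
          rw [show s⁻¹ * (δ m / φ (δ m)) * φ s = (φ s * δ m) / (φ (δ m) * s) by
            field_simp]
          exact (div_le_one (by positivity)).2 h1
    _ = _ := by rw [mul_one]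

/-- If `s / φ s → 0`, take `E k` with density comparable to `δ k` at the scale `7 / (k + 1)` around
every point of the unit ball, and let `u` be the supremum of the functions `χ_{E_k} / φ (δ k)`.
At a point outside all the `E k` the function `u` vanishes, but its averaged norm at these scales
is at least `φ (7⁻ⁿ δ k) / φ (δ k) ≥ 7⁻ⁿ`. -/
theorem not_lebesguePointProperty_of_tendsto_zero (hn : 1 ≤ n) {φ : ℝ → ℝ}
    (hφ : ConcaveOn ℝ (Ici 0) φ) (h0 : ∀ s, 0 ≤ s → 0 ≤ φ s) (hpos : ∀ s, 0 < s → 0 < φ s)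
    (hlim : Tendsto (fun s : ℝ => s / φ s) (𝓝[>] 0) (𝓝 0)) :
    ¬ LebesguePointProperty (marcinkiewiczNorm n φ) := by
  -- this first scale makes the union of all the sets `E k` below smaller than the unit ball
  obtain ⟨δ, hδ, hδ0, hδ2, hδ4⟩ := exists_scales hpos hlim
    (ε := 1 / (4 * 2 ^ n)) (by positivity)
  have hδle : ∀ k, δ k ≤ (1 / 2) ^ k * δ 0 := fun k => by
    simpa using le_pow_mul_of_succ_le (by norm_num) hδ2 0 k
  have hδ1 : ∀ k, δ k ≤ 1 := fun k => by
    refine (hδle k).trans (mul_le_one₀ (pow_le_one₀ (by norm_num) (by norm_num)) (hδ 0).le ?_)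
    rw [hδ0, div_le_one (by positivity)]
    linarith [one_le_pow₀ (M₀ := ℝ) one_le_two (n := n)]
  choose E hEm hEle hEge using fun k : ℕ => exists_small_spread_set hn (hδ k).le (hδ1 k)
    (Nat.one_div_pos_of_nat (α := ℝ) (n := k))
    ((div_le_one (by positivity)).2 (by linarith [(Nat.cast_nonneg k : (0 : ℝ) ≤ k)]))
  set V := volume (Metric.ball (0 : Rn n) 1)
  have hV0 : 0 < V := Metric.measure_ball_pos volume _ one_pos
  have hVfin : V ≠ ∞ := measure_ball_lt_top.ne
  set a : ℕ → ℝ := fun k => 1 / φ (δ k)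
  have hmem : levelSup E a ∈ localSpace (marcinkiewiczNorm n φ) := by
    refine ⟨(measurable_levelSup hEm).aemeasurable, fun K _ _ => ?_⟩
    exact lt_of_le_of_lt ((marcinkiewiczNorm_mono φ fun y => abs_indicator_le K _ y).trans
      (marcinkiewiczNorm_levelSup_le hφ h0 hpos hδ hδ2 hδ4 hEle)) (by finiteness)
  have hsmall : volume (⋃ k, E k) < V := by
    calc volume (⋃ k, E k) ≤ ∑' k, ENNReal.ofReal (δ k) * (ENNReal.ofReal (2 ^ n) * V) :=
          (measure_iUnion_le _).trans (ENNReal.tsum_le_tsum hEle)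
      _ ≤ 2 * ENNReal.ofReal (δ 0) * (ENNReal.ofReal (2 ^ n) * V) := by
          rw [ENNReal.tsum_mul_right]
          gcongr
          exact tsum_ofReal_le_two_mul hδle
      _ = 2⁻¹ * V := by
          rw [← mul_assoc, ← ENNReal.ofReal_ofNat 2, ← ENNReal.ofReal_mul zero_le_two,
            ← ENNReal.ofReal_mul (by have := hδ 0; positivity), ← ENNReal.ofReal_inv_of_pos two_pos,
            hδ0]
          congr 2
          field_simp
          norm_num
      _ < V := by
          rw [mul_comm, ← div_eq_mul_inv]
          exact ENNReal.half_lt_self hV0.ne' hVfin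
  intro hprop
  have hne : (volume.restrict (Metric.ball (0 : Rn n) 1 \ ⋃ k, E k)) ≠ 0 := by
    rw [Ne, Measure.restrict_eq_zero]
    intro h
    have := measure_le_inter_add_sdiff volume (Metric.ball (0 : Rn n) 1) (⋃ k, E k)
    rw [h, add_zero] at this
    exact absurd (this.trans (measure_mono inter_subset_right)) (not_le.2 hsmall)
  have : NeBot (ae (volume.restrict (Metric.ball (0 : Rn n) 1 \ ⋃ k, E k))) := ae_neBot.2 hne
  have hxmem : ∀ᵐ x ∂(volume.restrict (Metric.ball (0 : Rn n) 1 \ ⋃ k, E k)),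
      x ∈ Metric.ball (0 : Rn n) 1 \ ⋃ k, E k :=
    ae_restrict_mem (measurableSet_ball.diff (MeasurableSet.iUnion hEm))
  obtain ⟨x, hx, hxB, hxE⟩ := ((ae_restrict_of_ae (hprop _ hmem)).and hxmem).exists
  have hux : levelSup E a x = 0 := levelSup_eq_zero fun k hk => hxE (mem_iUnion.2 ⟨k, hk⟩)
  simp only [hux, sub_zero] at hx
  have hr : Tendsto (fun k : ℕ => 7 * (1 / ((k : ℝ) + 1))) atTop (𝓝[>] 0) := by
    refine tendsto_nhdsWithin_iff.2 ⟨?_, Eventually.of_forall fun k => ?_⟩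
    · simpa using (tendsto_one_div_add_atTop_nhds_zero_nat (𝕜 := ℝ)).const_mul 7
    · exact mem_Ioi.2 (by positivity)
  have hle : ∀ k : ℕ, ENNReal.ofReal (1 / 7 ^ n) ≤ averagedNorm (marcinkiewiczNorm n φ)
      (Metric.ball x (7 * (1 / ((k : ℝ) + 1)))) (levelSup E a) := by
    intro k
    set B := Metric.ball x (7 * (1 / ((k : ℝ) + 1)))
    have hB0 : volume B ≠ 0 := (Metric.measure_ball_pos volume x (by positivity)).ne'
    have hBfin : volume B ≠ ∞ := measure_ball_lt_top.ne
    have hak : 0 ≤ a k := one_div_nonneg.2 (hpos _ (hδ k)).le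
    refine le_trans ?_ (le_marcinkiewiczNorm (φ := φ) (s := 1 / 7 ^ n * δ k) (a := a k)
      (mul_pos (by positivity) (hδ k)) ?_)
    · rw [← ENNReal.ofReal_mul hak]
      refine ENNReal.ofReal_le_ofReal ?_
      have h1 := hφ.mul_le_map_mul h0 (c := 1 / 7 ^ n) (by positivity)
        ((div_le_one (by positivity)).2 (one_le_pow₀ (by norm_num))) (hδ k).le
      calc 1 / 7 ^ n = a k * (1 / 7 ^ n * φ (δ k)) := by
            have := (hpos _ (hδ k)).ne'
            simp only [a]; field_simp
        _ ≤ _ := by gcongr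
    · intro l hl hla
      rw [distribution_averaged hn hB0 hBfin, ← ENNReal.div_eq_inv_mul,
        ENNReal.le_div_iff_mul_le (Or.inl hB0) (Or.inl hBfin)]
      refine (hEge k x hxB).trans (measure_mono fun y hy => ?_)
      rw [mem_ofPred_eq, indicator_of_mem hy.2]
      exact lt_abs_levelSup hy.1 hl hla
  have := ge_of_tendsto (hx.comp hr) (Eventually.of_forall hle)
  exact absurd this (not_le.2 (ENNReal.ofReal_pos.2 (by positivity)))

end RINorm

theorem proposition1p4 (n : ℕ) (hn : 1 ≤ n) (φ : ℝ → ℝ)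
    (hφ_concave : ConcaveOn ℝ (Set.Ici 0) φ)
    (hφ_nonneg : ∀ s : ℝ, 0 ≤ s → 0 ≤ φ s)
    (hφ_ne : ∃ s : ℝ, 0 ≤ s ∧ φ s ≠ 0) :
    ∃ L : ℝ, Filter.Tendsto (fun s : ℝ => s / φ s) (𝓝[>] 0) (𝓝 L) ∧
      (RINorm.LebesguePointProperty (RINorm.marcinkiewiczNorm n φ) ↔ 0 < L) ∧
      (0 < L ↔
        RINorm.localSpace (RINorm.marcinkiewiczNorm n φ) =
          RINorm.localSpace (RINorm.lebesgueOneNorm n)) := by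
  have hpos := fun s (hs : 0 < s) => hφ_concave.pos_of_nonneg_of_ne_zero hφ_nonneg hφ_ne hs
  obtain ⟨L, hL0, hlim, hle⟩ := hφ_concave.exists_tendsto_div hφ_nonneg hφ_ne
  refine ⟨L, hlim, ⟨fun h => ?_, fun hL => RINorm.lebesguePointProperty_of_pos hn hL hpos hle⟩,
    fun hL => (RINorm.localSpace_marcinkiewicz_subset hpos).antisymm
      (RINorm.localSpace_lebesgueOne_subset hL hpos hle), fun h => ?_⟩
  · refine hL0.lt_of_ne fun hL => ?_
    rw [← hL] at hlim
    exact RINorm.not_lebesguePointProperty_of_tendsto_zero hn hφ_concave hφ_nonneg hpos hlim h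
  · refine hL0.lt_of_ne fun hL => ?_
    rw [← hL] at hlim
    exact RINorm.localSpace_ne_of_tendsto_zero hn hφ_concave hφ_nonneg hpos hlim h
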